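/- Let $\ell_1$ be the real Banach space of absolutely summable real sequences $x=(x_n)_{n\in\mathbb{N}}$ with $\|x\|_1=\sum_n|x_n|$, let $(e_n)$ be its standard basis, and let $$\mathbb{Z}_{\ell_1}=\Big\{\sum_{n=1}^{N}a_ne_n \,:\, N\in\mathbb{N}\cup\{0\},\ a_1,\dots,a_N\in\mathbb{Z}\Big\}\subset\ell_1$$ be the integer grid of $\ell_1$, with the metric inherited from $\ell_1$ and with base point $0$. For a metric space $(M,d)$ with a base point $0\in M$, let $\mathrm{Lip}_0(M)$ be the Banach space of all Lipschitz functions $f:M\to\mathbb{R}$ with $f(0)=0$, normed by the best Lipschitz constant $$\|f\|_L=\sup\Big\{\frac{|f(x)-f(y)|}{d(x,y)} \,:\, x\neq y\in M\Big\},$$ and let the Lipschitz-free space $\mathcal{F}(M)$ be the norm-closed linear span, in the dual $\mathrm{Lip}_0(M)^*$, of the evaluation functionals $\delta(x):f\mapsto f(x)$, $x\in M$. For a Banach space $X$, its countable $\ell_1$-sum $\big(\bigoplus_{\mathbb{N}}X\big)_1$ is the Banach space of all sequences $(x_n)_{n\in\mathbb{N}}$ in $X$ with $\|(x_n)\|=\sum_n\|x_n\|<\infty$.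 **Theorem.** The Lipschitz-free space $\mathcal{F}(\mathbb{Z}_{\ell_1})$ is linearly isomorphic to its countable $\ell_1$-sum; that is, there is a bijective linear map $$T:\mathcal{F}(\mathbb{Z}_{\ell_1})\to\Big(\bigoplus_{\mathbb{N}}\mathcal{F}(\mathbb{Z}_{\ell_1})\Big)_1$$ such that $T$ and $T^{-1}$ are bounded. -/

import Mathlib

noncomputable section

namespace FreeGrid

/-- The real vector space of Lipschitz functions `f : M → ℝ` with `f o = 0`,
as a subspace of all functions `M → ℝ`. -/
def lipZeroSubmodule (M : Type*) [MetricSpace M] (o : M) : Submodule ℝ (M → ℝ) where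
  carrier := {f | (∃ K : NNReal, LipschitzWith K f) ∧ f o = 0}
  zero_mem' := ⟨⟨0, LipschitzWith.const 0⟩, rfl⟩
  add_mem' := by
    rintro f g ⟨⟨K, hf⟩, hf0⟩ ⟨⟨L, hg⟩, hg0⟩
    exact ⟨⟨K + L, hf.add hg⟩, by simp [hf0, hg0]⟩
  smul_mem' := by
    rintro c f ⟨⟨K, hf⟩, hf0⟩
    exact ⟨⟨‖c‖₊ * K, (lipschitzWith_smul c).comp hf⟩, by simp [hf0]⟩

/-- The Lipschitz space `Lip₀(M)` of the metric space `M` with base point `o`. It is a type of its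
own (not a coerced subspace) so that the only norm it carries is the one defined below. -/
def LipZero (M : Type*) [MetricSpace M] (o : M) : Type _ := ↥(lipZeroSubmodule M o)

namespace LipZero

variable {M : Type*} [MetricSpace M] {o : M}

instance : AddCommGroup (LipZero M o) := inferInstanceAs (AddCommGroup ↥(lipZeroSubmodule M o))

instance : Module ℝ (LipZero M o) := inferInstanceAs (Module ℝ ↥(lipZeroSubmodule M o))

instance : CoeFun (LipZero M o) (fun _ => M → ℝ) := ⟨fun f => f.1⟩

/-- The best Lipschitz constant. Pairs `x = y` contribute `0 / 0 = 0`, which does not change the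
supremum over `x ≠ y`; the supremum is finite because `f` is Lipschitz. -/
instance : Norm (LipZero M o) := ⟨fun f => ⨆ p : M × M, |f p.1 - f p.2| / dist p.1 p.2⟩

theorem norm_def (f : LipZero M o) : ‖f‖ = ⨆ p : M × M, |f p.1 - f p.2| / dist p.1 p.2 := rfl

@[simp] theorem add_apply (f g : LipZero M o) (x : M) : (f + g) x = f x + g x := rfl

@[simp] theorem smul_apply (c : ℝ) (f : LipZero M o) (x : M) : (c • f) x = c * f x := rfl

@[simp] theorem zero_apply (x : M) : (0 : LipZero M o) x = 0 := rfl

theorem apply_base (f : LipZero M o) : f o = 0 := f.2.2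

theorem ext {f g : LipZero M o} (h : ∀ x, f x = g x) : f = g := Subtype.ext (funext h)

theorem bddAbove_slopes (f : LipZero M o) :
    BddAbove (Set.range fun p : M × M => |f p.1 - f p.2| / dist p.1 p.2) := by
  obtain ⟨K, hK⟩ := f.2.1
  refine ⟨K, ?_⟩
  rintro _ ⟨p, rfl⟩
  refine div_le_of_le_mul₀ dist_nonneg K.2 ?_
  simpa [Real.dist_eq] using hK.dist_le_mul p.1 p.2

theorem norm_nonneg' (f : LipZero M o) : 0 ≤ ‖f‖ :=
  Real.iSup_nonneg fun _ => div_nonneg (abs_nonneg _) dist_nonneg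

/-- `‖f‖` is a Lipschitz constant of `f`. -/
theorem abs_sub_le (f : LipZero M o) (x y : M) : |f x - f y| ≤ ‖f‖ * dist x y := by
  rcases eq_or_ne x y with rfl | h
  · simp
  · rw [← div_le_iff₀ (dist_pos.2 h)]
    exact le_ciSup f.bddAbove_slopes (x, y)

/-- `‖f‖` is the least Lipschitz constant of `f`. -/
theorem norm_le (f : LipZero M o) {C : ℝ} (hC : 0 ≤ C)
    (h : ∀ x y, |f x - f y| ≤ C * dist x y) : ‖f‖ ≤ C :=
  Real.iSup_le (fun p => div_le_of_le_mul₀ dist_nonneg hC (h p.1 p.2)) hC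

theorem core : NormedSpace.Core ℝ (LipZero M o) where
  norm_nonneg := norm_nonneg'
  norm_smul c f := by
    rw [norm_def, norm_def, Real.norm_eq_abs, Real.mul_iSup_of_nonneg (abs_nonneg c)]
    refine iSup_congr fun p => ?_
    rw [smul_apply, smul_apply, ← mul_sub, abs_mul, mul_div_assoc]
  norm_triangle f g := by
    refine norm_le _ (add_nonneg f.norm_nonneg' g.norm_nonneg') fun x y => ?_
    have h1 := f.abs_sub_le x y
    have h2 := g.abs_sub_le x y
    have h3 := abs_add_le (f x - f y) (g x - g y)
    have h4 : (f + g) x - (f + g) y = (f x - f y) + (g x - g y) := by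
      rw [add_apply, add_apply]; ring
    rw [h4, add_mul]
    linarith
  norm_eq_zero_iff f := by
    constructor
    · intro h
      refine ext fun x => ?_
      have h1 := f.abs_sub_le x o
      rw [h, zero_mul, f.apply_base, sub_zero] at h1
      simpa using h1
    · rintro rfl
      simp [norm_def]

instance : NormedAddCommGroup (LipZero M o) := NormedAddCommGroup.ofCore core

instance : NormedSpace ℝ (LipZero M o) := NormedSpace.ofCore core

end LipZero

/-- The evaluation functional `δ(x) ∈ Lip₀(M)*`, `f ↦ f x`. -/
def delta {M : Type*} [MetricSpace M] (o x : M) : StrongDual ℝ (LipZero M o) :=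
  LinearMap.mkContinuous
    { toFun := fun f => f x
      map_add' := fun _ _ => rfl
      map_smul' := fun _ _ => rfl } (dist x o) (by
    intro f
    have h := f.abs_sub_le x o
    rw [f.apply_base, sub_zero, mul_comm] at h
    exact h)

@[simp] theorem delta_apply {M : Type*} [MetricSpace M] (o x : M) (f : LipZero M o) :
    delta o x f = f x := rfl

/-- The Lipschitz-free space `F(M)` of the metric space `M` with base point `o`: the norm-closed
linear span of the evaluation functionals in `Lip₀(M)*`, with the dual norm. -/
def LipschitzFree (M : Type*) [MetricSpace M] (o : M) : Submodule ℝ (StrongDual ℝ (LipZero M o)) :=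
  (Submodule.span ℝ (Set.range (delta o))).topologicalClosure

/-- The real Banach space `ℓ₁`. -/
abbrev EllOne : Type := lp (fun _ : ℕ => ℝ) 1

/-- The integer grid of `ℓ₁`: finite integer combinations of the standard basis vectors.
It carries the metric of `ℓ₁`. -/
def grid : Set EllOne :=
  {x | ∃ (N : ℕ) (a : ℕ → ℤ), x = ∑ n ∈ Finset.range N, (a n : ℝ) • lp.single 1 n (1 : ℝ)}

theorem zero_mem_grid : (0 : EllOne) ∈ grid := ⟨0, 0, by simp⟩

/-- The Lipschitz-free space over the integer grid of `ℓ₁`, with base point `0`. -/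
abbrev FreeGridSpace : Type := LipschitzFree grid ⟨0, zero_mem_grid⟩

end FreeGrid

end

/-!
The argument applies to every normed abelian group `M` containing a sequence of disjoint balls with
exponentially growing radii, none of them containing the origin; the grid has the balls around
`2 ^ (m + 2) • e_m`. Let `X` be the Lipschitz-free space of `M`, and `ℓ₁(X)` its `ℓ₁`-sum.

By Pełczyński's decomposition method (`nonempty_equiv_ellOneSum`) it suffices to find bounded
operators `J : ℓ₁(X) → X` and `P : X → ℓ₁(X)` with `P ∘ J = id`. Both come from the universal
property of `X`: a Lipschitz map from `M` to a Banach space, vanishing at the base point, extends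
to `X` (`exists_free_lift`).

Number the balls by pairs `(k, n)`, so that the ball `(k, n)` around `c_{k,n}` has room for a copy
of the ball of radius `2 ^ (n + 1)` around the origin. With a dyadic partition of unity `φ_n` on
`[0, ∞)`, a point splits into its scales as `δ(x) = ∑ n, φ_n(‖x‖) δ(x)`; the map
`x ↦ (φ_n(‖x‖) δ(x))_n` into `ℓ₁(X)` is Lipschitz because the `φ_n` have Lipschitz constant
`O(2⁻ⁿ)` and live where `‖x‖` is about `2 ^ n` (`exists_scale_decomposition`). On the `k`-th summand,
`J` moves the `n`-th piece into the ball `(k, n)`,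
`J_k δ(x) = ∑ n, φ_n(‖x‖) (δ(x + c_{k,n}) - δ(c_{k,n}))`. The operator `P` cuts off
to the balls and moves the part in the ball `(k, n)` back to the origin in the `k`-th summand
(`exists_collection`). Then `P (J_k δ(x))` is `∑ n, φ_n(‖x‖) δ(x) = δ(x)`, in the `k`-th summand.
-/

noncomputable section

namespace FreeGrid

/-! ### Countable `ℓ₁`-sums -/

/-- The countable `ℓ₁`-sum of copies of `X`. -/
abbrev EllOneSum (X : Type*) [NormedAddCommGroup X] := lp (fun _ : ℕ => X) 1

namespace EllOneSum

variable {X : Type*} [NormedAddCommGroup X]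

theorem hasSum_norm (f : EllOneSum X) : HasSum (fun i => ‖f i‖) ‖f‖ := by
  simpa using lp.hasSum_norm (p := 1) (by simp) f

theorem norm_le_of_forall_sum_range_le {f : EllOneSum X} {C : ℝ}
    (h : ∀ N, ∑ i ∈ Finset.range N, ‖f i‖ ≤ C) : ‖f‖ ≤ C :=
  le_of_tendsto' (hasSum_norm f).tendsto_sum_nat h

theorem memℓp_of_forall_sum_range_le {f : ℕ → X} {C : ℝ}
    (h : ∀ N, ∑ i ∈ Finset.range N, ‖f i‖ ≤ C) : Memℓp f 1 :=
  memℓp_gen (by simpa using summable_of_sum_range_le (fun i => norm_nonneg (f i)) h)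

variable {E : Type*} [NormedSpace ℝ X] [NormedAddCommGroup E] [NormedSpace ℝ E]

theorem clm_ext {S T : EllOneSum X →L[ℝ] E}
    (h : ∀ i x, S (lp.single 1 i x) = T (lp.single 1 i x)) : S = T :=
  lp.ext_continuousLinearMap (by simp) fun i => ContinuousLinearMap.ext (h i)

variable [CompleteSpace E] (T : ℕ → X →L[ℝ] E) {C : ℝ}

theorem summable_desc (h : ∀ i x, ‖T i x‖ ≤ C * ‖x‖) (f : EllOneSum X) :
    Summable fun i => T i (f i) :=
  ((hasSum_norm f).summable.mul_left C).of_norm_bounded fun i => h i (f i)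

/-- The universal property of the `ℓ₁`-sum: a uniformly bounded sequence of operators `T i` is
glued to the operator `f ↦ ∑ i, T i (f i)`. -/
def desc (C : ℝ) (h : ∀ i x, ‖T i x‖ ≤ C * ‖x‖) : EllOneSum X →L[ℝ] E :=
  LinearMap.mkContinuous
    { toFun := fun f => ∑' i, T i (f i)
      map_add' := fun f g => by
        simp only [lp.coeFn_add, Pi.add_apply, map_add]
        exact (summable_desc T h f).tsum_add (summable_desc T h g)
      map_smul' := fun c f => by
        simp only [lp.coeFn_smul, Pi.smul_apply, map_smul, RingHom.id_apply]
        exact (summable_desc T h f).tsum_const_smul c } C (fun f =>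
    tsum_of_norm_bounded ((hasSum_norm f).mul_left C) fun i => h i (f i))

variable {T} (h : ∀ i x, ‖T i x‖ ≤ C * ‖x‖)

theorem norm_desc_le (f : EllOneSum X) : ‖desc T C h f‖ ≤ C * ‖f‖ :=
  tsum_of_norm_bounded ((hasSum_norm f).mul_left C) fun i => h i (f i)

theorem hasSum_desc (f : EllOneSum X) : HasSum (fun i => T i (f i)) (desc T C h f) :=
  (summable_desc T h f).hasSum

@[simp] theorem desc_single (i : ℕ) (x : X) : desc T C h (lp.single 1 i x) = T i x := by
  refine (hasSum_desc h _).unique ?_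
  convert hasSum_single i fun j hj => ?_
  · rw [lp.single_apply_self]
  · rw [lp.single_apply_ne _ _ _ hj, map_zero]

end EllOneSum

/-! ### Pełczyński decomposition -/

section Decomposition

variable (X : Type*) [NormedAddCommGroup X] [NormedSpace ℝ X]

open EllOneSum

/-- The inclusion of the `i`-th summand. -/
abbrev single (i : ℕ) : X →L[ℝ] EllOneSum X :=
  lp.singleContinuousLinearMap ℝ (fun _ : ℕ => X) 1 i

theorem norm_single_apply (i : ℕ) (x : X) : ‖single X i x‖ = ‖x‖ :=
  lp.norm_single (E := fun _ : ℕ => X) (by simp) i x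

variable [CompleteSpace X]

/-- Splitting an `ℓ₁`-sum into two `ℓ₁`-sums along the bijection `ℕ ⊕ ℕ ≃ ℕ`. -/
def splitEquiv : (EllOneSum X × EllOneSum X) ≃L[ℝ] EllOneSum X :=
  let e := Equiv.natSumNatEquivNat
  ContinuousLinearEquiv.equivOfInverse'
    ((desc (fun i => single X (e (.inl i))) 1 fun i x => by
        rw [norm_single_apply, one_mul]).coprod
      (desc (fun i => single X (e (.inr i))) 1 fun i x => by
        rw [norm_single_apply, one_mul]))
    (desc (fun n => Sum.elim (fun i => (ContinuousLinearMap.inl ℝ _ _).comp (single X i))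
      (fun i => (ContinuousLinearMap.inr ℝ _ _).comp (single X i)) (e.symm n)) 1 fun n x => by
        rcases e.symm n with i | i <;> simp [Prod.norm_def, lp.norm_single])
    (by
      refine clm_ext fun n x => ?_
      obtain ⟨i | i, rfl⟩ := e.surjective n <;> simp)
    (by
      refine ContinuousLinearMap.prod_ext (clm_ext fun i x => ?_) (clm_ext fun i x => ?_) <;>
        simp)

/-- Prepending one more summand to an `ℓ₁`-sum. -/
def consEquiv : (X × EllOneSum X) ≃L[ℝ] EllOneSum X :=
  ContinuousLinearEquiv.equivOfInverse'
    ((single X 0).coprod (desc (fun i => single X (i + 1)) 1 fun i x => by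
        rw [norm_single_apply, one_mul]))
    (desc (fun n => n.casesOn (ContinuousLinearMap.inl ℝ _ _)
      (fun i => (ContinuousLinearMap.inr ℝ _ _).comp (single X i))) 1 fun n x => by
        rcases n with _ | i <;> simp [Prod.norm_def, lp.norm_single])
    (by
      refine clm_ext fun n x => ?_
      rcases n with _ | i <;> simp)
    (by
      refine ContinuousLinearMap.prod_ext ?_ (clm_ext fun i x => ?_)
      · ext1 x; simp
      · simp)

variable {X}

/-- Pełczyński's decomposition method. With `Y` the kernel of `P` and `ℓ₁(X)` the `ℓ₁`-sum,
`X ≃ ℓ₁(X) × Y ≃ ℓ₁(X) × ℓ₁(X) × Y ≃ ℓ₁(X) × X ≃ ℓ₁(X)`. -/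
theorem nonempty_equiv_ellOneSum (P : X →L[ℝ] EllOneSum X) (J : EllOneSum X →L[ℝ] X)
    (h : Function.RightInverse J P) : Nonempty (X ≃L[ℝ] EllOneSum X) := by
  have e := ContinuousLinearEquiv.equivOfRightInverse P J h
  exact ⟨e.trans <| ((splitEquiv X).symm.prodCongr (.refl ℝ _)).trans <|
    (ContinuousLinearEquiv.prodAssoc ℝ _ _ _).trans <|
    ((ContinuousLinearEquiv.refl ℝ _).prodCongr e.symm).trans <|
    (ContinuousLinearEquiv.prodComm ℝ _ _).trans (consEquiv X)⟩

end Decomposition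

/-! ### The universal property of the Lipschitz-free space -/

section Free

variable {M : Type*} [MetricSpace M] {o : M}

/-- The Lipschitz-free space as a type of its own, carrying only the structure that comes from its
norm. The submodule `LipschitzFree M o` also inherits algebraic and topological instances from the
dual of `LipZero M o`, which agree with those of the norm only after unfolding. -/
def Free (M : Type*) [MetricSpace M] (o : M) : Type _ := LipschitzFree M o

instance : NormedAddCommGroup (Free M o) :=
  inferInstanceAs (NormedAddCommGroup (LipschitzFree M o))

instance : NormedSpace ℝ (Free M o) := inferInstanceAs (NormedSpace ℝ (LipschitzFree M o))

instance : CompleteSpace (Free M o) :=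
  (Submodule.isClosed_topologicalClosure
    (Submodule.span ℝ (Set.range (delta o)))).completeSpace_coe

/-- The inclusion of the Lipschitz-free space into the dual of `Lip₀(M)`. -/
def Free.incl : Free M o →ₗᵢ[ℝ] StrongDual ℝ (LipZero M o) := (LipschitzFree M o).subtypeₗᵢ

/-- The canonical embedding `x ↦ δ(x)` of `M` into its Lipschitz-free space. -/
def ev (o x : M) : Free M o :=
  ⟨delta o x, Submodule.le_topologicalClosure _ (Submodule.subset_span ⟨x, rfl⟩)⟩

theorem ev_base : ev o o = (0 : Free M o) :=
  Subtype.ext (ContinuousLinearMap.ext fun f => f.apply_base)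

theorem norm_ev_sub_le (x y : M) : ‖ev o x - ev o y‖ ≤ dist x y := by
  change ‖delta o x - delta o y‖ ≤ _
  refine ContinuousLinearMap.opNorm_le_bound _ dist_nonneg fun f => ?_
  rw [mul_comm]
  exact f.abs_sub_le x y

theorem norm_ev_le (x : M) : ‖ev o x‖ ≤ dist x o := by
  simpa [ev_base] using norm_ev_sub_le (o := o) x o

variable {E : Type*} [NormedAddCommGroup E] [NormedSpace ℝ E]

theorem free_hom_ext {S T : Free M o →L[ℝ] E} (h : ∀ x, S (ev o x) = T (ev o x)) :
    S = T := by
  have hcl : IsClosed (((LinearMap.eqLocus S.toLinearMap T.toLinearMap).map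
      (Free.incl (o := o)).toLinearMap : Submodule ℝ _) : Set (StrongDual ℝ (LipZero M o))) :=
    Free.incl.isometry.isClosedEmbedding.isClosedMap _
      (isClosed_eq S.continuous T.continuous)
  have hle := Submodule.topologicalClosure_minimal (Submodule.span ℝ (Set.range (delta o))) (by
    rw [Submodule.span_le]
    rintro _ ⟨x, rfl⟩
    exact ⟨ev o x, h x, rfl⟩) hcl
  ext1 m
  obtain ⟨m', hm', h'⟩ := hle m.2
  rwa [Free.incl.injective h'] at hm'

/-- Composition with a Lipschitz map `g`, as an operator from the dual of `E` to `Lip₀(M)`. -/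
def dualPullback (g : M → E) (K : NNReal) (hg : LipschitzWith K g) (h0 : g o = 0) :
    StrongDual ℝ E →L[ℝ] LipZero M o :=
  LinearMap.mkContinuous
    { toFun := fun φ => ⟨fun x => φ (g x), ⟨_, φ.lipschitz.comp hg⟩, by simp [h0]⟩
      map_add' := fun _ _ => rfl
      map_smul' := fun _ _ => rfl } K (fun φ => by
    refine LipZero.norm_le _ (by positivity) fun x y => ?_
    have h1 : |φ (g x) - φ (g y)| ≤ ‖φ‖ * ‖g x - g y‖ := by
      rw [← map_sub]
      exact φ.le_opNorm _
    have h2 := hg.dist_le_mul x y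
    rw [dist_eq_norm] at h2
    calc |φ (g x) - φ (g y)| ≤ ‖φ‖ * (K * dist x y) := h1.trans (by gcongr)
      _ = K * ‖φ‖ * dist x y := by ring)

theorem exists_factor_through_isometry {V F : Type*} [NormedAddCommGroup V] [NormedSpace ℝ V]
    [NormedAddCommGroup F] [NormedSpace ℝ F] (ι : E →ₗᵢ[ℝ] F) (A : V →L[ℝ] F)
    (hA : ∀ v, ∃ e, ι e = A v) : ∃ T : V →L[ℝ] E, ∀ v, ι (T v) = A v := by
  let B := A.codRestrict (LinearMap.range ι.toLinearMap) hA
  refine ⟨ι.equivRange.symm.toContinuousLinearEquiv.toContinuousLinearMap.comp B, fun v => ?_⟩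
  exact congrArg Subtype.val (ι.equivRange.apply_symm_apply (B v))

/-- The universal property of the Lipschitz-free space. The extension is the adjoint of
`dualPullback`, which maps `δ(x)` to the image of `g x` in the bidual, hence the closed span of the
`δ(x)` into the closed subspace `E` of the bidual. -/
theorem exists_free_lift [CompleteSpace E] (g : M → E) (K : NNReal) (hg : LipschitzWith K g)
    (h0 : g o = 0) :
    ∃ T : Free M o →L[ℝ] E, (∀ x, T (ev o x) = g x) ∧ ∀ m, ‖T m‖ ≤ K * ‖m‖ := by
  let ι : E →ₗᵢ[ℝ] StrongDual ℝ (StrongDual ℝ E) := NormedSpace.inclusionInDoubleDualLi ℝ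
  let Q := dualPullback (o := o) g K hg h0
  have hQ : ‖Q‖ ≤ K := LinearMap.mkContinuous_norm_le _ K.2 _
  let A : StrongDual ℝ (LipZero M o) →L[ℝ] StrongDual ℝ (StrongDual ℝ E) :=
    (ContinuousLinearMap.compL ℝ (StrongDual ℝ E) (LipZero M o) ℝ).flip Q
  have hA : ∀ x, A (delta o x) = ι (g x) := fun x => rfl
  have hrange : ∀ m : Free M o, ∃ e, ι e = A m.incl := by
    have hcl : IsClosed (LinearMap.range ι.toLinearMap : Set (StrongDual ℝ (StrongDual ℝ E))) :=
      ι.isometry.isUniformInducing.isComplete_range.isClosed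
    have : LipschitzFree M o ≤ (LinearMap.range ι.toLinearMap).comap A.toLinearMap := by
      refine Submodule.topologicalClosure_minimal _ ?_ (hcl.preimage A.continuous)
      rw [Submodule.span_le]
      rintro _ ⟨x, rfl⟩
      exact ⟨g x, (hA x).symm⟩
    exact fun m => this m.2
  obtain ⟨T, hT⟩ := exists_factor_through_isometry (V := Free M o)
    (F := StrongDual ℝ (StrongDual ℝ E)) ι
    (A.comp Free.incl.toContinuousLinearMap) hrange
  refine ⟨T, fun x => ι.injective ((hT _).trans (hA x)), fun m => ?_⟩
  calc ‖T m‖ = ‖ι (T m)‖ := (ι.norm_map _).symm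
    _ = ‖m.incl.comp Q‖ := by rw [hT]; rfl
    _ ≤ ‖m.incl‖ * ‖Q‖ := ContinuousLinearMap.opNorm_comp_le _ _
    _ ≤ K * ‖m‖ := by rw [mul_comm]; gcongr; rfl

end Free

/-! ### Dyadic cutoffs and the associated partition of unity -/

/-- The cutoff at scale `2 ^ n`: equal to `1` on `t ≤ 2 ^ n`, to `0` on `t ≥ 2 ^ (n + 1)`, and
affine in between. -/
def cutoff (n : ℕ) (t : ℝ) : ℝ := max 0 (min 1 (2 - t / 2 ^ n))

theorem cutoff_nonneg (n : ℕ) (t : ℝ) : 0 ≤ cutoff n t := le_max_left _ _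

theorem cutoff_le_one (n : ℕ) (t : ℝ) : cutoff n t ≤ 1 :=
  max_le zero_le_one (min_le_left _ _)

theorem cutoff_eq_one {n : ℕ} {t : ℝ} (h : t ≤ 2 ^ n) : cutoff n t = 1 := by
  have : t / 2 ^ n ≤ 1 := (div_le_one (by positivity)).2 h
  rw [cutoff, min_eq_left (by linarith), max_eq_right zero_le_one]

theorem cutoff_eq_zero {n : ℕ} {t : ℝ} (h : 2 ^ (n + 1) ≤ t) : cutoff n t = 0 := by
  have : 2 ≤ t / 2 ^ n := (le_div_iff₀ (by positivity)).2 (by rwa [pow_succ'] at h)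
  exact max_eq_left ((min_le_right _ _).trans (by linarith))

theorem abs_cutoff_sub_le (n : ℕ) (s t : ℝ) : |cutoff n s - cutoff n t| ≤ |s - t| / 2 ^ n := by
  have h1 := abs_max_sub_max_le_abs (min 1 (2 - s / 2 ^ n)) (min 1 (2 - t / 2 ^ n)) 0
  have h2 := abs_min_sub_min_le_max 1 (2 - s / 2 ^ n) 1 (2 - t / 2 ^ n)
  have h3 : |2 - s / 2 ^ n - (2 - t / 2 ^ n)| = |s - t| / 2 ^ n := by
    rw [show 2 - s / 2 ^ n - (2 - t / 2 ^ n) = -((s - t) / 2 ^ n) by ring, abs_neg, abs_div,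
      abs_of_pos (show (0 : ℝ) < 2 ^ n by positivity)]
  rw [h3, sub_self, abs_zero, max_eq_right (by positivity)] at h2
  rw [cutoff, cutoff, max_comm 0, max_comm 0]
  exact h1.trans h2

theorem cutoff_mono (t : ℝ) (ht : 0 ≤ t) : Monotone fun n => cutoff n t := by
  intro m n hmn
  have : t / 2 ^ n ≤ t / 2 ^ m := by gcongr; norm_num
  exact max_le_max le_rfl (min_le_min le_rfl (by linarith))

theorem sum_ite_div_two_pow_le (N : ℕ) {t : ℝ} (ht : 0 ≤ t) :
    ∑ n ∈ Finset.range N, (if t < 2 ^ n then t / 2 ^ n else 0) ≤ 2 := by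
  induction N generalizing t with
  | zero => simp
  | succ N ih =>
    by_cases h1 : t < 1
    · calc ∑ n ∈ Finset.range (N + 1), (if t < 2 ^ n then t / 2 ^ n else 0)
          ≤ ∑ n ∈ Finset.range (N + 1), (1 / 2 : ℝ) ^ n := by
            refine Finset.sum_le_sum fun n _ => ?_
            rw [div_pow, one_pow]
            split_ifs
            · gcongr
            · positivity
        _ ≤ 2 := sum_geometric_two_le _
    · rw [Finset.sum_range_succ']
      have h2 := ih (t := t / 2) (by positivity)
      have h3 : ∀ n : ℕ, (if t < 2 ^ (n + 1) then t / 2 ^ (n + 1) else 0) =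
          if t / 2 < 2 ^ n then t / 2 / 2 ^ n else 0 := fun n => by
        simp only [div_lt_iff₀ (two_pos (α := ℝ)), ← pow_succ, div_div, ← pow_succ']
      simpa [h3, h1] using h2

/-- Only the scales with `t < 2 ^ (n + 1)` contribute, and on these the Lipschitz constants
`1 / 2 ^ n` of the cutoffs sum up geometrically to `O(1 / t)`. -/
theorem sum_abs_cutoff_sub_mul_le (N : ℕ) {s t : ℝ} (ht : 0 ≤ t) (hts : t ≤ s) :
    ∑ n ∈ Finset.range N, |cutoff n s - cutoff n t| * t ≤ 4 * (s - t) := by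
  calc ∑ n ∈ Finset.range N, |cutoff n s - cutoff n t| * t
      ≤ ∑ n ∈ Finset.range N, (2 * (s - t)) * (if t / 2 < 2 ^ n then t / 2 / 2 ^ n else 0) := by
        refine Finset.sum_le_sum fun n _ => ?_
        split_ifs with h
        · have := abs_cutoff_sub_le n s t
          rw [abs_of_nonneg (sub_nonneg.2 hts)] at this
          calc |cutoff n s - cutoff n t| * t ≤ (s - t) / 2 ^ n * t := by gcongr
            _ = _ := by ring
        · have h' : 2 ^ (n + 1) ≤ t := by rw [pow_succ]; linarith
          rw [cutoff_eq_zero h', cutoff_eq_zero (h'.trans hts)]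
          simp
    _ = 2 * (s - t) * ∑ n ∈ Finset.range N, (if t / 2 < 2 ^ n then t / 2 / 2 ^ n else 0) :=
        (Finset.mul_sum _ _ _).symm
    _ ≤ 2 * (s - t) * 2 := by
        have := sub_nonneg.2 hts
        gcongr
        exact sum_ite_div_two_pow_le N (by positivity)
    _ = 4 * (s - t) := by ring

/-- The partition of unity on `[0, ∞)` whose `n`-th member lives at scale `2 ^ n`. -/
def bump : ℕ → ℝ → ℝ
  | 0, t => cutoff 0 t
  | n + 1, t => cutoff (n + 1) t - cutoff n t

theorem bump_nonneg (n : ℕ) {t : ℝ} (ht : 0 ≤ t) : 0 ≤ bump n t := by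
  cases n with
  | zero => exact cutoff_nonneg _ _
  | succ n => exact sub_nonneg.2 (cutoff_mono t ht n.le_succ)

theorem sum_bump (N : ℕ) (t : ℝ) : ∑ n ∈ Finset.range (N + 1), bump n t = cutoff N t := by
  induction N with
  | zero => simp [bump]
  | succ N ih => rw [Finset.sum_range_succ, ih, bump]; ring

theorem sum_bump_le_one (N : ℕ) (t : ℝ) : ∑ n ∈ Finset.range N, bump n t ≤ 1 := by
  cases N with
  | zero => simp
  | succ N => rw [sum_bump]; exact cutoff_le_one _ _

theorem hasSum_bump {t : ℝ} (ht : 0 ≤ t) : HasSum (fun n => bump n t) 1 := by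
  rw [hasSum_iff_tendsto_nat_of_nonneg fun n => bump_nonneg n ht,
    ← Filter.tendsto_add_atTop_iff_nat 1]
  obtain ⟨N, hN⟩ := pow_unbounded_of_one_lt t one_lt_two
  refine tendsto_const_nhds.congr' ?_
  filter_upwards [Filter.eventually_ge_atTop N] with n hn
  rw [sum_bump, cutoff_eq_one]
  exact hN.le.trans (pow_le_pow_right₀ one_le_two hn)

theorem bump_eq_zero {n : ℕ} {t : ℝ} (h : 2 ^ (n + 1) ≤ t) : bump n t = 0 := by
  cases n with
  | zero => exact cutoff_eq_zero h
  | succ n =>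
    rw [bump, cutoff_eq_zero h, cutoff_eq_zero, sub_zero]
    exact (pow_le_pow_right₀ one_le_two (Nat.le_succ _)).trans h

/-- The Lipschitz estimate on which `exists_scale_decomposition` rests. -/
theorem sum_abs_bump_sub_mul_le (N : ℕ) {s t : ℝ} (ht : 0 ≤ t) (hts : t ≤ s) :
    ∑ n ∈ Finset.range N, |bump n s - bump n t| * t ≤ 8 * (s - t) := by
  cases N with
  | zero => simpa using hts
  | succ N =>
    have h1 := sum_abs_cutoff_sub_mul_le (N + 1) ht hts
    have h2 := sum_abs_cutoff_sub_mul_le N ht hts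
    rw [Finset.sum_range_succ'] at h1 ⊢
    have h3 : ∑ n ∈ Finset.range N, |bump (n + 1) s - bump (n + 1) t| * t ≤
        ∑ n ∈ Finset.range N, |cutoff (n + 1) s - cutoff (n + 1) t| * t +
          ∑ n ∈ Finset.range N, |cutoff n s - cutoff n t| * t := by
      rw [← Finset.sum_add_distrib]
      refine Finset.sum_le_sum fun n _ => ?_
      rw [← add_mul]
      gcongr
      rw [bump, bump, sub_sub_sub_comm]
      exact abs_sub _ _
    rw [bump, bump]
    linarith

/-! ### Operators on the Lipschitz-free space of a normed group -/

section NormedGroup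

variable {M : Type*} [NormedAddCommGroup M]

theorem norm_ev_zero_le (x : M) : ‖ev 0 x‖ ≤ ‖x‖ := by
  simpa using norm_ev_le (o := 0) x

theorem norm_smul_sub_smul_le {E : Type*} [NormedAddCommGroup E] [NormedSpace ℝ E] (a b : ℝ)
    (v w : E) : ‖a • v - b • w‖ ≤ |a| * ‖v - w‖ + |a - b| * ‖w‖ := by
  rw [show a • v - b • w = a • (v - w) + (a - b) • w by module]
  exact (norm_add_le _ _).trans_eq (by simp only [norm_smul, Real.norm_eq_abs])

/-- Translation by `c`, corrected by `ev 0 c` so that the base point is mapped to `0`. -/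
theorem exists_translation (c : M) : ∃ T : Free M 0 →L[ℝ] Free M 0,
    (∀ x, T (ev 0 x) = ev 0 (x + c) - ev 0 c) ∧ ∀ m, ‖T m‖ ≤ 1 * ‖m‖ := by
  have := exists_free_lift (o := (0 : M)) (fun x => ev 0 (x + c) - ev 0 c) 1
    (LipschitzWith.of_dist_le_mul fun x y => by
      refine (dist_eq_norm _ _).trans_le ?_
      rw [sub_sub_sub_cancel_right]
      simpa using norm_ev_sub_le (o := 0) (x + c) (y + c)) (by simp)
  simpa using this

theorem lipschitzWith_cutoff_smul_ev (n : ℕ) :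
    LipschitzWith 3 fun x : M => cutoff n ‖x‖ • ev 0 x := by
  have key : ∀ x y : M, ‖y‖ ≤ ‖x‖ →
      ‖cutoff n ‖x‖ • ev 0 x - cutoff n ‖y‖ • ev 0 y‖ ≤ 3 * dist x y := by
    intro x y hyx
    rcases le_or_gt (2 ^ (n + 1)) ‖y‖ with h | h
    · rw [cutoff_eq_zero h, cutoff_eq_zero (h.trans hyx)]
      simp
    · have h1 := norm_smul_sub_smul_le (cutoff n ‖x‖) (cutoff n ‖y‖) (ev 0 x) (ev 0 y)
      have h2 : |cutoff n ‖x‖| * ‖ev 0 x - ev 0 y‖ ≤ 1 * dist x y := by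
        gcongr
        · rw [abs_of_nonneg (cutoff_nonneg _ _)]
          exact cutoff_le_one _ _
        · exact norm_ev_sub_le _ _
      have h3 : |cutoff n ‖x‖ - cutoff n ‖y‖| * ‖ev 0 y‖ ≤ dist x y / 2 ^ n * 2 ^ (n + 1) := by
        gcongr
        · refine (abs_cutoff_sub_le n _ _).trans ?_
          gcongr
          rw [dist_eq_norm]
          exact abs_norm_sub_norm_le x y
        · exact (norm_ev_zero_le y).trans h.le
      have h4 : dist x y / 2 ^ n * 2 ^ (n + 1) = 2 * dist x y := by
        rw [pow_succ]
        field_simp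
      linarith
  refine LipschitzWith.of_dist_le_mul fun x y => ?_
  refine (dist_eq_norm _ _).trans_le ?_
  push_cast
  rcases le_total ‖y‖ ‖x‖ with h | h
  · exact key x y h
  · rw [norm_sub_rev, dist_comm]
    exact key y x h

/-- Spreading a point over its dyadic scales, in the style of Kalton: `δ(x)` is mapped to the
sequence `bump n ‖x‖ • δ(x)`. -/
theorem exists_scale_decomposition : ∃ S : Free M 0 →L[ℝ] EllOneSum (Free M 0),
    (∀ x n, S (ev 0 x) n = bump n ‖x‖ • ev 0 x) ∧ ∀ m, ‖S m‖ ≤ 9 * ‖m‖ := by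
  have hmem : ∀ x : M, Memℓp (fun n => bump n ‖x‖ • ev 0 x) 1 := fun x => by
    refine EllOneSum.memℓp_of_forall_sum_range_le (C := 1 * ‖ev 0 x‖) fun N => ?_
    simp only [norm_smul, Real.norm_of_nonneg (bump_nonneg _ (norm_nonneg x))]
    rw [← Finset.sum_mul]
    gcongr
    exact sum_bump_le_one _ _
  let g : M → EllOneSum (Free M 0) := fun x => ⟨fun n => bump n ‖x‖ • ev 0 x, hmem x⟩
  have key : ∀ x y : M, ‖y‖ ≤ ‖x‖ → ‖g x - g y‖ ≤ 9 * dist x y := by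
    intro x y hyx
    refine EllOneSum.norm_le_of_forall_sum_range_le fun N => ?_
    calc ∑ n ∈ Finset.range N, ‖(g x - g y) n‖
        ≤ ∑ n ∈ Finset.range N, (bump n ‖x‖ * dist x y + |bump n ‖x‖ - bump n ‖y‖| * ‖y‖) := by
          refine Finset.sum_le_sum fun n _ => ?_
          refine (norm_smul_sub_smul_le (bump n ‖x‖) (bump n ‖y‖) (ev 0 x) (ev 0 y)).trans ?_
          rw [abs_of_nonneg (bump_nonneg n (norm_nonneg x))]
          have := bump_nonneg n (norm_nonneg x)
          gcongr
          · exact norm_ev_sub_le _ _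
          · exact norm_ev_zero_le y
      _ ≤ 1 * dist x y + 8 * (‖x‖ - ‖y‖) := by
          rw [Finset.sum_add_distrib, ← Finset.sum_mul]
          gcongr
          · exact sum_bump_le_one _ _
          · exact sum_abs_bump_sub_mul_le N (norm_nonneg y) hyx
      _ ≤ 9 * dist x y := by
          have := norm_sub_norm_le x y
          rw [← dist_eq_norm] at this
          linarith
  obtain ⟨S, hS, hS'⟩ := exists_free_lift (o := (0 : M)) g 9
    (LipschitzWith.of_dist_le_mul fun x y => by
      refine (dist_eq_norm _ _).trans_le ?_
      push_cast
      rcases le_total ‖y‖ ‖x‖ with h | h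
      · exact key x y h
      · rw [norm_sub_rev, dist_comm]
        exact key y x h)
    (lp.ext (funext fun n => show bump n ‖(0 : M)‖ • ev 0 (0 : M) = 0 by rw [ev_base, smul_zero]))
  exact ⟨S, fun x n => by rw [hS], hS'⟩

/-- Lipschitz functions with disjoint supports have a Lipschitz sum: if `z` and `w` lie in the
supports of `u m` and `u n` with `m ≠ n`, then `u m w = 0 = u n z`. -/
theorem lipschitzWith_finsum_of_disjoint {E : Type*} [NormedAddCommGroup E] {u : ℕ → M → E}
    {K : NNReal} (hu : ∀ m, LipschitzWith K (u m))
    (hd : ∀ z m m', m ≠ m' → u m z = 0 ∨ u m' z = 0) :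
    LipschitzWith (2 * K) fun z => ∑ᶠ m, u m z := by
  have hz : ∀ z, ∃ m, ∑ᶠ i, u i z = u m z ∧ ∀ m', m' ≠ m → u m' z = 0 := by
    intro z
    have : ∃ m, ∀ m', m' ≠ m → u m' z = 0 := by
      by_cases h : ∃ m, u m z ≠ 0
      · obtain ⟨m, hm⟩ := h
        exact ⟨m, fun m' h' => (hd z m' m h').resolve_right hm⟩
      · push Not at h
        exact ⟨0, fun m' _ => h m'⟩
    obtain ⟨m, hm⟩ := this
    exact ⟨m, finsum_eq_single _ m hm, hm⟩
  refine LipschitzWith.of_dist_le_mul fun z w => ?_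
  obtain ⟨m, hm, hm0⟩ := hz z
  obtain ⟨n, hn, hn0⟩ := hz w
  have h1 := (hu m).dist_le_mul z w
  have h2 := (hu n).dist_le_mul z w
  have h3 : 0 ≤ K * dist z w := by positivity
  simp only [hm, hn]
  push_cast
  rcases eq_or_ne m n with rfl | hmn
  · linarith
  · rw [hn0 m hmn] at h1
    rw [hm0 n hmn.symm] at h2
    linarith [dist_triangle (u m z) 0 (u n w)]

/-- Cutting a point `z` out of disjoint balls around centres `c m`: the ball around
`c m` recovers `δ(z - c m)` and puts it into the summand with index `(Nat.unpair m).1`. -/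
theorem exists_collection (c : ℕ → M) (hc0 : ∀ m, 2 ^ (m + 2) ≤ ‖c m‖)
    (hc : ∀ m m', m ≠ m' → 2 ^ (m + 2) + 2 ^ (m' + 2) ≤ ‖c m - c m'‖) :
    ∃ P : Free M 0 →L[ℝ] EllOneSum (Free M 0), ∀ k n x, ‖x‖ ≤ 2 ^ (n + 1) →
      P (ev 0 (x + c (Nat.pair k n))) = lp.single 1 k (ev 0 x) := by
  let u : ℕ → M → EllOneSum (Free M 0) := fun m z =>
    single _ m.unpair.1 (cutoff (m.unpair.2 + 1) ‖z - c m‖ • ev 0 (z - c m))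
  have hpow : ∀ {a b : ℕ}, a ≤ b → (2 : ℝ) ^ a ≤ 2 ^ b := pow_le_pow_right₀ one_le_two
  have hu0 : ∀ m z, 2 ^ (m + 2) ≤ ‖z - c m‖ → u m z = 0 := fun m z h => by
    have : cutoff (m.unpair.2 + 1) ‖z - c m‖ = 0 :=
      cutoff_eq_zero ((hpow (by have := m.unpair_right_le; omega)).trans h)
    simp only [u, this, zero_smul, map_zero]
  have hu : ∀ m, LipschitzWith 3 (u m) := fun m => by
    refine LipschitzWith.of_dist_le_mul fun z w => ?_
    have := (lipschitzWith_cutoff_smul_ev (m.unpair.2 + 1)).dist_le_mul (z - c m) (w - c m)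
    rw [dist_sub_right] at this
    refine (dist_eq_norm _ _).trans_le ?_
    rw [← map_sub, norm_single_apply, ← dist_eq_norm]
    exact this
  have hd : ∀ z m m', m ≠ m' → u m z = 0 ∨ u m' z = 0 := by
    intro z m m' hmm
    by_contra! h
    have h1 : ‖z - c m‖ < 2 ^ (m + 2) := not_le.1 fun h' => h.1 (hu0 m z h')
    have h2 : ‖z - c m'‖ < 2 ^ (m' + 2) := not_le.1 fun h' => h.2 (hu0 m' z h')
    have h3 := norm_sub_le (z - c m') (z - c m)
    rw [sub_sub_sub_cancel_left] at h3
    linarith [hc m m' hmm]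
  obtain ⟨P, hP, -⟩ := exists_free_lift (o := (0 : M)) (fun z => ∑ᶠ m, u m z) _
    (lipschitzWith_finsum_of_disjoint hu hd)
    (by simp only [fun m => hu0 m 0 (by simpa using hc0 m), finsum_zero])
  refine ⟨P, fun k n x hx => ?_⟩
  rw [hP, finsum_eq_single _ (Nat.pair k n)]
  · simp [u, cutoff_eq_one hx]
  · intro m hm
    refine hu0 m _ ?_
    have h1 := hc (Nat.pair k n) m hm.symm
    have h2 := norm_sub_le (x + c (Nat.pair k n) - c m) x
    rw [add_sub_assoc, add_sub_cancel_left, ← add_sub_assoc] at h2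
    have h3 : (2 : ℝ) ^ (n + 1) ≤ 2 ^ (Nat.pair k n + 2) :=
      hpow (by have := Nat.right_le_pair k n; omega)
    linarith

/-- The Lipschitz-free space of a normed group is isomorphic to its `ℓ₁`-sum as soon as the group
contains disjoint balls of radii `2 ^ (m + 2)`, none of them containing the origin. -/
theorem nonempty_free_equiv_ellOneSum (c : ℕ → M) (hc0 : ∀ m, 2 ^ (m + 2) ≤ ‖c m‖)
    (hc : ∀ m m', m ≠ m' → 2 ^ (m + 2) + 2 ^ (m' + 2) ≤ ‖c m - c m'‖) :
    Nonempty (Free M 0 ≃L[ℝ] EllOneSum (Free M 0)) := by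
  obtain ⟨P, hP⟩ := exists_collection c hc0 hc
  obtain ⟨S, hS, hSn⟩ := exists_scale_decomposition (M := M)
  choose τ hτ hτn using exists_translation (M := M)
  -- `R k` puts the part of a point at scale `n` into the ball numbered `Nat.pair k n`, so that each
  -- `k` has its own balls of all radii.
  let R : ℕ → EllOneSum (Free M 0) →L[ℝ] Free M 0 := fun k =>
    EllOneSum.desc (fun n => τ (c (Nat.pair k n))) 1 fun n m => hτn _ m
  let J := EllOneSum.desc (fun k => (R k).comp S) 9 fun k m =>
    (EllOneSum.norm_desc_le (fun n m => hτn (c (Nat.pair k n)) m) (S m)).trans (by rw [one_mul]; exact hSn m)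
  have hPJ : ∀ k x, P (R k (S (ev 0 x))) = lp.single 1 k (ev 0 x) := by
    intro k x
    have h1 : HasSum (fun n => P (τ (c (Nat.pair k n)) (S (ev 0 x) n))) (P (R k (S (ev 0 x)))) :=
      (EllOneSum.hasSum_desc _ _).mapL P
    have h2 : ∀ n, P (τ (c (Nat.pair k n)) (S (ev 0 x) n)) =
        bump n ‖x‖ • lp.single 1 k (ev 0 x) := by
      intro n
      rw [hS, map_smul, map_smul]
      rcases le_or_gt (2 ^ (n + 1)) ‖x‖ with h | h
      · rw [bump_eq_zero h, zero_smul, zero_smul]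
      · have h0 := hP k n 0 (by simp)
        rw [zero_add, ev_base, lp.single_zero] at h0
        rw [hτ, map_sub, hP k n x h.le, h0, sub_zero]
    simp only [h2] at h1
    simpa using h1.unique ((hasSum_bump (norm_nonneg x)).smul_const _)
  -- `P ∘ J = id` need only be checked on the `δ(x)` in each summand, which is `hPJ`.
  refine nonempty_equiv_ellOneSum P J fun f => ?_
  have hid : P.comp J = .id ℝ _ := by
    refine EllOneSum.clm_ext fun k m => ?_
    have : (P.comp (R k)).comp S = single _ k := free_hom_ext fun x => hPJ k x
    exact (congrArg P (EllOneSum.desc_single _ k m)).trans (DFunLike.congr_fun this m)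
  exact DFunLike.congr_fun hid f

end NormedGroup

/-! ### The integer grid -/

/-- The integer grid as a subgroup of `ℓ₁`; its elements and its metric are those of `grid`. -/
def gridSubgroup : AddSubgroup EllOne where
  carrier := grid
  zero_mem' := zero_mem_grid
  add_mem' := by
    rintro _ _ ⟨N, a, rfl⟩ ⟨N', a', rfl⟩
    have extend : ∀ (N N' : ℕ) (a : ℕ → ℤ), N ≤ N' →
        ∑ n ∈ Finset.range N, (a n : ℝ) • (lp.single 1 n (1 : ℝ) : EllOne) =
          ∑ n ∈ Finset.range N', ((if n < N then a n else 0 : ℤ) : ℝ) • lp.single 1 n (1 : ℝ) := by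
      intro N N' a h
      rw [← Finset.sum_subset (Finset.range_mono h)]
      · exact Finset.sum_congr rfl fun n hn => by rw [if_pos (Finset.mem_range.1 hn)]
      · intro n _ hn
        rw [if_neg (by simpa using hn), Int.cast_zero, zero_smul]
    refine ⟨max N N', fun n => (if n < N then a n else 0) + (if n < N' then a' n else 0), ?_⟩
    rw [extend N _ a (le_max_left _ _), extend N' _ a' (le_max_right _ _),
      ← Finset.sum_add_distrib]
    simp only [Int.cast_add, add_smul]
  neg_mem' := by
    rintro _ ⟨N, a, rfl⟩
    exact ⟨N, fun n => -a n, by simp⟩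

theorem smul_single_mem_grid (a : ℤ) (n : ℕ) :
    (a : ℝ) • (lp.single 1 n (1 : ℝ) : EllOne) ∈ gridSubgroup := by
  refine ⟨n + 1, Pi.single n a, ?_⟩
  rw [Finset.sum_eq_single_of_mem n (by simp)]
  · simp
  · intro m _ hm
    simp [hm]

/-- The centre `2 ^ (m + 2) • e_m`. -/
def gridCentre (m : ℕ) : gridSubgroup :=
  ⟨((2 ^ (m + 2) : ℤ) : ℝ) • lp.single 1 m (1 : ℝ), smul_single_mem_grid _ _⟩

theorem norm_gridCentre (m : ℕ) : ‖gridCentre m‖ = 2 ^ (m + 2) := by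
  change ‖((2 ^ (m + 2) : ℤ) : ℝ) • (lp.single 1 m (1 : ℝ) : EllOne)‖ = _
  rw [norm_smul, lp.norm_single (by simp)]
  simp

theorem le_norm_gridCentre_sub {m m' : ℕ} (h : m ≠ m') :
    2 ^ (m + 2) + 2 ^ (m' + 2) ≤ ‖gridCentre m - gridCentre m'‖ := by
  have key := lp.sum_rpow_le_norm_rpow (p := 1) (by simp)
    ((gridCentre m - gridCentre m' : gridSubgroup) : EllOne) {m, m'}
  have hval : ∀ i, ((gridCentre m - gridCentre m' : gridSubgroup) : EllOne) i =
      2 ^ (m + 2) * (Pi.single m (1 : ℝ) : ℕ → ℝ) i -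
        2 ^ (m' + 2) * (Pi.single m' (1 : ℝ) : ℕ → ℝ) i := fun i => by
    change ((2 ^ (m + 2) : ℤ) : ℝ) * _ - ((2 ^ (m' + 2) : ℤ) : ℝ) * _ = _
    push_cast
    rfl
  rw [Finset.sum_pair h, hval, hval] at key
  simpa [h, h.symm] using key

end FreeGrid

end

/-- The Lipschitz-free space over the integer grid of `ℓ₁` is linearly isomorphic, as a Banach
space, to its countable `ℓ₁`-sum. -/
theorem theorem3p11 :
    Nonempty (FreeGrid.FreeGridSpace ≃L[ℝ] lp (fun _ : ℕ => FreeGrid.FreeGridSpace) 1) :=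
  FreeGrid.nonempty_free_equiv_ellOneSum (M := FreeGrid.gridSubgroup) FreeGrid.gridCentre
    (fun m => (FreeGrid.norm_gridCentre m).ge) fun _ _ h => FreeGrid.le_norm_gridCentre_sub h
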